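/- Let $\mathbb{N}=\{0,1,2,\ldots\}$, let $\lambda\in\{2,3\}$, and let $m$ be a positive integer of the form $m=4^a(4b+1)$ with $a,b\in\mathbb{N}$. Then there exist $x,y,z,w\in\mathbb{N}$ with $m=x^2+y^2+z^2+w^2$ such that $x+2y+\lambda z$ is a positive square, i.e. $x+2y+\lambda z=k^2$ for some positive integer $k$. -/

import Mathlib

/-! Multiplying a representation by 4 multiplies the linear form by 4, so only m = M and m = 4M with
M = 4b + 1 matter. Split (x, y, z) along and across (1, 2, λ). Fixing the linear form at k² leaves m
as a fixed multiple of k⁴ plus the norm of the rest, and the three-square theorem supplies that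
rest. Congruences modulo 3 (λ = 2) or 14 (λ = 3), needed for integrality, are met by permutations
and sign changes. Nonnegativity follows from Cauchy–Schwarz once k⁴ is large relative to m. A
suitable k exists for all large m; smaller M are checked by computation, with twice a square as the
linear form when m = 4M. -/

/-- `M` is a sum of four squares `x² + y² + z² + w²` with `x + 2y + lam z` equal to `c` times a
positive square. -/
def LinSquareRep (lam c M : ℕ) : Prop :=
  ∃ x y z w : ℕ, M = x ^ 2 + y ^ 2 + z ^ 2 + w ^ 2 ∧
    ∃ k : ℕ, 0 < k ∧ x + 2 * y + lam * z = c * k ^ 2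

/-! ### Finite verification by bit masks -/

/-- Bitwise disjunction of `f 0, …, f (n - 1)`. -/
def orBelow (f : ℕ → ℕ) : ℕ → ℕ
  | 0 => 0
  | n + 1 => Nat.lor (orBelow f n) (f n)

theorem testBit_orBelow {f : ℕ → ℕ} {n b : ℕ} (h : (orBelow f n).testBit b = true) :
    ∃ i < n, (f i).testBit b = true := by
  induction n with
  | zero => simp [orBelow] at h
  | succ n ih =>
    have h' : (orBelow f n ||| f n).testBit b = true := h
    rw [Nat.testBit_or, Bool.or_eq_true] at h'
    rcases h' with h' | h'
    · obtain ⟨i, hi, h⟩ := ih h'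
      exact ⟨i, by omega, h⟩
    · exact ⟨n, by omega, h'⟩

/-- The bit mask of the numbers `f 0, …, f (n - 1)`. -/
def valueMask (f : ℕ → ℕ) (n : ℕ) : ℕ :=
  orBelow (fun w => Nat.shiftLeft 1 (f w)) n

theorem testBit_valueMask_shiftLeft {f : ℕ → ℕ} {n s b : ℕ}
    (h : (Nat.shiftLeft (valueMask f n) s).testBit b = true) : ∃ w, b = s + f w := by
  have h' : (valueMask f n <<< s).testBit b = true := h
  rw [Nat.testBit_shiftLeft, Bool.and_eq_true, decide_eq_true_eq] at h'
  obtain ⟨w, -, hw⟩ := testBit_orBelow h'.2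
  have hw' : (1 <<< f w).testBit (b - s) = true := hw
  rw [Nat.one_shiftLeft, Nat.testBit_two_pow, decide_eq_true_eq] at hw'
  exact ⟨w, by omega⟩

/-- The mask of those `b` for which `4b + 1 - s` is a square, for `s ≡ 0, 1` modulo `4`. -/
def remainderMask (n s : ℕ) : ℕ :=
  -- 4b + 1 = s + (2w)² means b = s/4 + w², and 4b + 1 = s + (2w + 1)² means b = s/4 + w(w + 1),
  -- with s/4 rounded down. One shift thus treats every w at once.
  bif Nat.beq (Nat.mod s 4) 1 then Nat.shiftLeft (valueMask (fun w => Nat.mul w w) n) (Nat.div s 4)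
  else bif Nat.beq (Nat.mod s 4) 0 then
    Nat.shiftLeft (valueMask (fun w => Nat.mul w (Nat.add w 1)) n) (Nat.div s 4)
  else 0

theorem testBit_remainderMask {n s b : ℕ} (h : (remainderMask n s).testBit b = true) :
    ∃ w, 4 * b + 1 = s + w ^ 2 := by
  unfold remainderMask at h
  have hs : Nat.mod s 4 = s % 4 := rfl
  have hd : Nat.div s 4 = s / 4 := rfl
  cases h1 : Nat.beq (Nat.mod s 4) 1
  · cases h0 : Nat.beq (Nat.mod s 4) 0
    · simp [h1, h0] at h
    · rw [h1, h0] at h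
      obtain ⟨w, hw⟩ := testBit_valueMask_shiftLeft h
      have hw' : b = s / 4 + w * (w + 1) := hw
      have := Nat.eq_of_beq_eq_true h0
      refine ⟨2 * w + 1, ?_⟩
      have e : (2 * w + 1) ^ 2 = 4 * (w * (w + 1)) + 1 := by ring
      omega
  · rw [h1] at h
    obtain ⟨w, hw⟩ := testBit_valueMask_shiftLeft h
    have hw' : b = s / 4 + w * w := hw
    have := Nat.eq_of_beq_eq_true h1
    refine ⟨2 * w, ?_⟩
    have e : (2 * w) ^ 2 = 4 * (w * w) := by ring
    omega

/-- The mask contributed by the triple `(T - 2y - lam z, y, z)`. -/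
def tripleMask (lam n bound T y z : ℕ) : ℕ :=
  bif Nat.ble (Nat.add (Nat.mul 2 y) (Nat.mul lam z)) T then
    (fun s => bif Nat.ble s bound then remainderMask n s else 0)
      ((fun x => Nat.add (Nat.mul x x) (Nat.add (Nat.mul y y) (Nat.mul z z)))
        (Nat.sub T (Nat.add (Nat.mul 2 y) (Nat.mul lam z))))
  else 0

theorem testBit_tripleMask {lam n bound T y z b : ℕ}
    (h : (tripleMask lam n bound T y z).testBit b = true) :
    ∃ x w, 4 * b + 1 = x ^ 2 + y ^ 2 + z ^ 2 + w ^ 2 ∧ x + 2 * y + lam * z = T := by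
  unfold tripleMask at h
  cases h1 : Nat.ble (Nat.add (Nat.mul 2 y) (Nat.mul lam z)) T
  · simp only [h1, cond_false, Nat.zero_testBit, Bool.false_eq_true] at h
  have hT : 2 * y + lam * z ≤ T := Nat.le_of_ble_eq_true h1
  simp only [h1, cond_true] at h
  generalize hx : Nat.sub T (Nat.add (Nat.mul 2 y) (Nat.mul lam z)) = x at h
  have hx' : T - (2 * y + lam * z) = x := hx
  cases h2 : Nat.ble (Nat.add (Nat.mul x x) (Nat.add (Nat.mul y y) (Nat.mul z z))) bound
  · simp only [h2, cond_false, Nat.zero_testBit, Bool.false_eq_true] at h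
  simp only [h2, cond_true] at h
  obtain ⟨w, hw⟩ := testBit_remainderMask h
  have hw' : 4 * b + 1 = x * x + (y * y + z * z) + w ^ 2 := hw
  exact ⟨x, w, by rw [hw']; ring, by omega⟩

/-- The mask obtained from the triples with linear form `c (k + 1) ^ 2`, `k < K`, in boxes of side
`r` around the minimum of `x² + y² + z²`. -/
def searchMask (lam c n bound r K : ℕ) : ℕ :=
  orBelow (fun k => (fun T => (fun y₀ z₀ =>
    orBelow (fun i => orBelow (fun j =>
      tripleMask lam n bound T (Nat.sub (Nat.add y₀ i) (Nat.div r 2))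
        (Nat.sub (Nat.add z₀ j) (Nat.div r 2))) r) r)
      (Nat.div (Nat.mul 2 T) (Nat.add 5 (Nat.mul lam lam)))
      (Nat.div (Nat.mul lam T) (Nat.add 5 (Nat.mul lam lam))))
      (Nat.mul c (Nat.mul (Nat.add k 1) (Nat.add k 1)))) K

theorem testBit_searchMask {lam c n bound r K b : ℕ}
    (h : (searchMask lam c n bound r K).testBit b = true) : LinSquareRep lam c (4 * b + 1) := by
  obtain ⟨k, -, h⟩ := testBit_orBelow h
  obtain ⟨i, -, h⟩ := testBit_orBelow h
  obtain ⟨j, -, h⟩ := testBit_orBelow h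
  obtain ⟨x, w, h1, h2⟩ := testBit_tripleMask h
  have h3 : Nat.mul c (Nat.mul (Nat.add k 1) (Nat.add k 1)) = c * (k + 1) ^ 2 := by
    rw [sq]; rfl
  exact ⟨x, _, _, w, h1, k + 1, Nat.succ_pos k, h2.trans h3⟩

theorem linSquareRep_of_searchMask {lam c n bound r K B : ℕ}
    (h : Nat.beq (Nat.mod (searchMask lam c n bound r K) (Nat.pow 2 B))
      (Nat.sub (Nat.pow 2 B) 1) = true)
    {b : ℕ} (hb : b < B) : LinSquareRep lam c (4 * b + 1) := by
  have h' : searchMask lam c n bound r K % 2 ^ B = 2 ^ B - 1 := Nat.eq_of_beq_eq_true h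
  apply testBit_searchMask (n := n) (bound := bound) (r := r) (K := K)
  have h2 : (searchMask lam c n bound r K % 2 ^ B).testBit b = true := by
    rw [h', Nat.testBit_two_pow_sub_one]
    simpa using hb
  rw [Nat.testBit_mod_two_pow, Bool.and_eq_true] at h2
  exact h2.2

theorem linSquareRep_two_two {b : ℕ} (hb : b < 21610) : LinSquareRep 2 2 (4 * b + 1) :=
  linSquareRep_of_searchMask (n := 148) (bound := 4 * 21610) (r := 21) (K := 21)
    (by decide +kernel) hb

theorem linSquareRep_two_one {b : ℕ} (hb : b < 86437) : LinSquareRep 2 1 (4 * b + 1) :=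
  linSquareRep_of_searchMask (n := 295) (bound := 4 * 86437) (r := 29) (K := 42)
    (by decide +kernel) hb

theorem linSquareRep_three_one {b : ℕ} (hb : b < 151841) : LinSquareRep 3 1 (4 * b + 1) :=
  linSquareRep_of_searchMask (n := 391) (bound := 4 * 151841) (r := 23) (K := 54)
    (by decide +kernel) hb

theorem linSquareRep_three_two {b : ℕ} (hb : b < 107188) : LinSquareRep 3 2 (4 * b + 1) :=
  linSquareRep_of_searchMask (n := 328) (bound := 4 * 107188) (r := 25) (K := 35)
    (by decide +kernel) hb

/-! ### Reduction of binary and ternary forms -/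

theorem Int.exists_two_mul_add_mul_mem (a d : ℤ) (ha : 0 < a) :
    ∃ k : ℤ, -a ≤ 2 * (d + k * a) ∧ 2 * (d + k * a) ≤ a := by
  refine ⟨-((2 * d + a) / (2 * a)), ?_, ?_⟩
  · have := Int.mul_ediv_self_le (x := 2 * d + a) (k := 2 * a) (by omega)
    linarith
  · have := Int.lt_mul_ediv_self_add (x := 2 * d + a) (k := 2 * a) (by omega)
    linarith

/-- Lagrange reduction: a positive definite binary form of determinant `D` has a primitive value
whose square is at most `4D/3`. -/
theorem exists_unimodular_binary_reduction (N : ℕ) : ∀ A B C : ℤ, A ≤ N → 0 < A →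
    0 < A * C - B ^ 2 → ∃ p q r s : ℤ, p * s - q * r = 1 ∧
      0 < A * p ^ 2 + 2 * B * p * r + C * r ^ 2 ∧
      3 * (A * p ^ 2 + 2 * B * p * r + C * r ^ 2) ^ 2 ≤ 4 * (A * C - B ^ 2) := by
  induction N with
  | zero => intro A B C hN hA; push_cast at hN; omega
  | succ N ih =>
    intro A B C hN hA hD
    obtain ⟨k, hk1, hk2⟩ := Int.exists_two_mul_add_mul_mem A B hA
    have hC : A * (C + 2 * B * k + A * k ^ 2) - (B + k * A) ^ 2 = A * C - B ^ 2 := by ring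
    have hpos : 0 < C + 2 * B * k + A * k ^ 2 := by
      refine pos_of_mul_pos_right (a := A) ?_ hA.le
      nlinarith [sq_nonneg (B + k * A)]
    -- Either the shifted last coefficient is smaller and the two are exchanged, or A² ≤ D + A²/4.
    rcases lt_or_ge (C + 2 * B * k + A * k ^ 2) A with hlt | hge
    · obtain ⟨p, q, r, s, h1, h2, h3⟩ := ih (C + 2 * B * k + A * k ^ 2) (-(B + k * A)) A
        (by push_cast at hN; omega) hpos (by linarith)
      have e : A * (-r + k * p) ^ 2 + 2 * B * (-r + k * p) * p + C * p ^ 2 =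
          (C + 2 * B * k + A * k ^ 2) * p ^ 2 + 2 * -(B + k * A) * p * r + A * r ^ 2 := by ring
      refine ⟨-r + k * p, -s + k * q, p, q, by linarith, by rw [e]; exact h2, ?_⟩
      rw [e]
      linarith
    · refine ⟨1, 0, 0, 1, by ring, by simpa using hA, ?_⟩
      have hB : 4 * (B + k * A) ^ 2 ≤ A ^ 2 := by nlinarith
      nlinarith [mul_le_mul_of_nonneg_left hge hA.le]

theorem binary_form_det_one_eq_sum_two_squares (A B C : ℤ) (hA : 0 < A)
    (hD : A * C - B ^ 2 = 1) (y z : ℤ) :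
    ∃ u v : ℤ, A * y ^ 2 + 2 * B * y * z + C * z ^ 2 = u ^ 2 + v ^ 2 := by
  obtain ⟨p, q, r, s, h1, h2, h3⟩ := exists_unimodular_binary_reduction A.toNat A B C
    (by omega) hA (by omega)
  have hA' : A * p ^ 2 + 2 * B * p * r + C * r ^ 2 = 1 := by nlinarith
  refine ⟨(s * y - q * z) + (A * p * q + B * (p * s + q * r) + C * r * s) * (p * z - r * y),
    p * z - r * y, ?_⟩
  set Y := s * y - q * z
  set Z := p * z - r * y
  have hy : y = p * Y + q * Z := by simp only [Y, Z]; linear_combination (-y) * h1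
  have hz : z = r * Y + s * Z := by simp only [Y, Z]; linear_combination (-z) * h1
  have hdet : (A * q ^ 2 + 2 * B * q * s + C * s ^ 2) =
      1 + (A * p * q + B * (p * s + q * r) + C * r * s) ^ 2 := by
    have : (A * p ^ 2 + 2 * B * p * r + C * r ^ 2) * (A * q ^ 2 + 2 * B * q * s + C * s ^ 2)
        - (A * p * q + B * (p * s + q * r) + C * r * s) ^ 2 = 1 := by
      linear_combination (A * C - B ^ 2) * (p * s - q * r + 1) * h1 + hD
    rw [hA'] at this
    linarith
  rw [hy, hz]
  linear_combination Y ^ 2 * hA' + Z ^ 2 * hdet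

theorem Int.not_three_mul_sq_le_of_two_le {a A : ℤ} (ha : 2 ≤ a) (hA : 3 * A ^ 2 ≤ 4 * a) :
    ¬ 3 * a ^ 2 ≤ 4 * A := by
  intro h
  have h1 : (3 * a ^ 2) ^ 2 ≤ (4 * A) ^ 2 := pow_le_pow_left₀ (by positivity) h 2
  have h2 : a * (27 * a ^ 3) ≤ a * 64 := by linarith
  have h3 := le_of_mul_le_mul_left h2 (by omega)
  have h4 : (2 : ℤ) ^ 3 ≤ a ^ 3 := pow_le_pow_left₀ (by norm_num) ha 3
  linarith

/-- A positive definite integral ternary form with even cross terms and determinant `1` takes only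
values that are sums of three squares. -/
theorem ternary_form_det_one_eq_sum_three_squares (N : ℕ) : ∀ a b c d e f : ℤ, a ≤ N → 0 < a →
    0 < a * b - d ^ 2 →
    a * b * c + 2 * d * e * f - a * f ^ 2 - b * e ^ 2 - c * d ^ 2 = 1 → ∀ x y z : ℤ,
    ∃ u v w : ℤ, a * x ^ 2 + b * y ^ 2 + c * z ^ 2 + 2 * d * x * y + 2 * e * x * z + 2 * f * y * z =
      u ^ 2 + v ^ 2 + w ^ 2 := by
  induction N with
  | zero => intro a b c d e f hN ha; push_cast at hN; omega
  | succ N ih =>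
    intro a b c d e f hN ha hm hdet x y z
    have hD : (a * b - d ^ 2) * (a * c - e ^ 2) - (a * f - d * e) ^ 2 = a := by
      linear_combination a * hdet
    rcases eq_or_lt_of_le (show (1 : ℤ) ≤ a by omega) with rfl | ha2
    · obtain ⟨u, v, huv⟩ := binary_form_det_one_eq_sum_two_squares _ _ _ hm hD y z
      exact ⟨x + d * y + e * z, u, v, by linear_combination huv⟩
    -- The form times a is (ax + dy + ez)² plus a binary form of determinant a. Reducing the latter
    -- and then shifting by k yields a leading coefficient b' < a.
    obtain ⟨p, q, r, s, h1, h2, h3⟩ := exists_unimodular_binary_reduction (a * b - d ^ 2).toNat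
      _ (a * f - d * e) (a * c - e ^ 2) (by omega) hm (by omega)
    rw [hD] at h3
    set A := (a * b - d ^ 2) * p ^ 2 + 2 * (a * f - d * e) * p * r + (a * c - e ^ 2) * r ^ 2 with hA
    obtain ⟨k, hk1, hk2⟩ := Int.exists_two_mul_add_mul_mem a (d * p + e * r) ha
    set d' := d * p + e * r + k * a with hd'
    set b' := b * p ^ 2 + 2 * f * p * r + c * r ^ 2 + 2 * (d * p + e * r) * k + a * k ^ 2 with hb'
    have hab : a * b' - d' ^ 2 = A := by simp only [hb', hd', hA]; ring
    have hb'pos : 0 < b' := by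
      refine pos_of_mul_pos_right (a := a) ?_ ha.le
      nlinarith [sq_nonneg d']
    have hd'a : 4 * d' ^ 2 ≤ a ^ 2 := by nlinarith
    have hb'lt : b' < a := by
      by_contra! hle
      have h4 : 3 * a ^ 2 ≤ 4 * A := by nlinarith [mul_le_mul_of_nonneg_left hle ha.le]
      exact Int.not_three_mul_sq_le_of_two_le ha2 h3 h4
    obtain ⟨u, v, w, h⟩ := ih b' a (b * q ^ 2 + 2 * f * q * s + c * s ^ 2) d'
      (b * p * q + f * (p * s + q * r) + c * r * s + (d * q + e * s) * k) (d * q + e * s)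
      (by push_cast at hN; omega) hb'pos (by linarith)
      (by
        simp only [hb', hd']
        linear_combination (a * b * c + 2 * d * e * f - a * f ^ 2 - b * e ^ 2 - c * d ^ 2) *
          (p * s - q * r + 1) * h1 + hdet)
      (s * y - q * z) (x - k * (s * y - q * z)) (p * z - r * y)
    refine ⟨u, v, w, h ▸ ?_⟩
    set Y := s * y - q * z
    set Z := p * z - r * y
    have hy : y = p * Y + q * Z := by simp only [Y, Z]; linear_combination (-y) * h1
    have hz : z = r * Y + s * Z := by simp only [Y, Z]; linear_combination (-z) * h1
    simp only [hb', hd']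
    rw [hy, hz]
    ring

/-! ### Sums of three squares, via Dirichlet's theorem and reciprocity -/

theorem sum_three_squares_of_dvd {n : ℕ} {b c : ℤ} (hb : 0 < b) (hbn : 0 < b * n - 1)
    (h : b * n - 1 ∣ b + c ^ 2) : ∃ u v w : ℤ, (n : ℤ) = u ^ 2 + v ^ 2 + w ^ 2 := by
  obtain ⟨a, ha⟩ := h
  have ha0 : 0 < a := by
    refine pos_of_mul_pos_right (a := b * n - 1) ?_ hbn.le
    nlinarith [sq_nonneg c]
  -- The matrix with rows (a, c, 1), (c, bn - 1, 0), (1, 0, n) has determinant 1 and represents n at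
  -- (0, 0, 1).
  obtain ⟨u, v, w, huvw⟩ := ternary_form_det_one_eq_sum_three_squares a.toNat a (b * n - 1) n c 1 0
    (by omega) ha0 (by linarith) (by linear_combination (-(n : ℤ)) * ha) 0 0 1
  exact ⟨u, v, w, by rw [← huvw]; ring⟩

theorem exists_dvd_add_sq_of_jacobiSym_neg_eq_one {p : ℕ} [Fact p.Prime] {b : ℤ}
    (h : jacobiSym (-b) p = 1) : ∃ c : ℤ, (p : ℤ) ∣ b + c ^ 2 := by
  obtain ⟨c, hc⟩ := ZMod.isSquare_of_jacobiSym_eq_one h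
  refine ⟨c.val, ?_⟩
  rw [← ZMod.intCast_zmod_eq_zero_iff_dvd]
  push_cast at hc ⊢
  rw [ZMod.natCast_zmod_val]
  linear_combination -hc

theorem sum_three_squares_of_mod_four_eq_two {n : ℕ} (hn : n % 4 = 2) :
    ∃ u v w : ℤ, (n : ℤ) = u ^ 2 + v ^ 2 + w ^ 2 := by
  obtain ⟨p, hpn, hp, hmod⟩ := Nat.forall_exists_prime_gt_and_modEq n (q := 4 * n) (a := n - 1)
    (by omega) (by
      refine Nat.Coprime.mul_right ?_ ?_
      · exact Nat.Coprime.pow_right 2 (Nat.coprime_two_right.mpr (by rw [Nat.odd_iff]; omega))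
      · exact (Nat.coprime_self_sub_left (m := 1) (by omega)).mpr (Nat.coprime_one_left n))
  have := Fact.mk hp
  obtain ⟨v, hv⟩ := (Nat.modEq_iff_dvd' (by omega : n - 1 ≤ p)).mp hmod.symm
  have hp' : p + 1 = (4 * v + 1) * n := by
    have : p = 4 * n * v + (n - 1) := by omega
    rw [this]
    have : n - 1 + 1 = n := by omega
    linarith
  have hp4 : p % 4 = 1 := by
    have : 4 * n * v = 4 * (n * v) := by ring
    omega
  have hJ : jacobiSym (-((4 * v + 1 : ℕ) : ℤ)) p = 1 := by
    rw [jacobiSym.neg _ (Nat.odd_iff.mpr (by omega)), ZMod.χ₄_nat_one_mod_four hp4, one_mul,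
      jacobiSym.quadratic_reciprocity_one_mod_four' (Nat.odd_iff.mpr (by omega)) hp4,
      jacobiSym.mod_left' (a₂ := -1), jacobiSym.at_neg_one (Nat.odd_iff.mpr (by omega)),
      ZMod.χ₄_nat_one_mod_four (by omega)]
    exact Int.modEq_iff_dvd.mpr ⟨-n, by zify at hp'; push_cast; linarith⟩
  obtain ⟨c, hc⟩ := exists_dvd_add_sq_of_jacobiSym_neg_eq_one hJ
  have hp'' : ((4 * v + 1 : ℕ) : ℤ) * n - 1 = p := by
    rw [← Nat.cast_mul, ← hp']; push_cast; ring
  refine sum_three_squares_of_dvd (b := ((4 * v + 1 : ℕ) : ℤ)) (by positivity) ?_ (c := c) ?_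
  · rw [hp'']; exact_mod_cast hp.pos
  · rw [hp'']; exact hc

theorem sum_three_squares_of_mod_four_eq_one {n : ℕ} (hn : n % 4 = 1) :
    ∃ u v w : ℤ, (n : ℤ) = u ^ 2 + v ^ 2 + w ^ 2 := by
  obtain ⟨h, hh⟩ : ∃ h, 3 * n = 2 * h + 1 := ⟨3 * n / 2, by omega⟩
  obtain ⟨p, hpn, hp, hmod⟩ := Nat.forall_exists_prime_gt_and_modEq (h + 2) (q := 4 * n) (a := h)
    (by omega) (by
      refine Nat.Coprime.mul_right ?_ ?_
      · exact Nat.Coprime.pow_right 2 (Nat.coprime_two_right.mpr (by rw [Nat.odd_iff]; omega))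
      · refine Nat.isCoprime_iff_coprime.mp ⟨-2, 3, ?_⟩
        zify at hh; linarith)
  have := Fact.mk hp
  obtain ⟨v, hv⟩ := (Nat.modEq_iff_dvd' (by omega : h ≤ p)).mp hmod.symm
  have hv' : p = 4 * (n * v) + h := by rw [← mul_assoc]; omega
  have hp' : 2 * p + 1 = (8 * v + 3) * n := by rw [hv']; linarith
  have hb4 : (8 * v + 3) % 4 = 3 := by omega
  have hbodd : Odd (8 * v + 3) := Nat.odd_iff.mpr (by omega)
  have hpodd : Odd p := Nat.odd_iff.mpr (by omega)
  have hJ' : jacobiSym (p : ℤ) (8 * v + 3) = 1 := by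
    have h1 : jacobiSym (-2) (8 * v + 3) = 1 := by
      rw [jacobiSym.at_neg_two hbodd, ZMod.χ₈'_nat_eq_if_mod_eight]
      simp [Nat.add_mod, Nat.mul_mod]
    have h2 : jacobiSym (-2 * p) (8 * v + 3) = 1 := by
      rw [jacobiSym.mod_left' (a₂ := 1), jacobiSym.one_left]
      exact Int.modEq_iff_dvd.mpr ⟨n, by zify at hp'; push_cast; linarith⟩
    rwa [jacobiSym.mul_left, h1, one_mul] at h2
  have hJ : jacobiSym (-((8 * v + 3 : ℕ) : ℤ)) p = 1 := by
    rw [jacobiSym.neg _ hpodd]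
    have hp4 : p % 4 = 1 ∨ p % 4 = 3 := by omega
    rcases hp4 with hp4 | hp4
    · rw [ZMod.χ₄_nat_one_mod_four hp4, one_mul,
        jacobiSym.quadratic_reciprocity_one_mod_four' hbodd hp4, hJ']
    · rw [ZMod.χ₄_nat_three_mod_four hp4,
        jacobiSym.quadratic_reciprocity_three_mod_four hb4 hp4, hJ']
      norm_num
  obtain ⟨c, hc⟩ := exists_dvd_add_sq_of_jacobiSym_neg_eq_one hJ
  have hp'' : ((8 * v + 3 : ℕ) : ℤ) * n - 1 = 2 * p := by
    rw [← Nat.cast_mul, ← hp']; push_cast; ring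
  -- Adding the odd p makes c odd, so that 2 as well as p divides b + c².
  obtain ⟨c', hc', hodd⟩ : ∃ c' : ℤ, (p : ℤ) ∣ ((8 * v + 3 : ℕ) : ℤ) + c' ^ 2 ∧ Odd c' := by
    rcases Int.even_or_odd c with he | ho
    · refine ⟨c + p, ?_, he.add_odd (by exact_mod_cast hpodd)⟩
      have : ((8 * v + 3 : ℕ) : ℤ) + (c + p) ^ 2 =
          ((8 * v + 3 : ℕ) : ℤ) + c ^ 2 + p * (2 * c + p) := by ring
      rw [this]
      exact dvd_add hc (dvd_mul_right _ _)
    · exact ⟨c, hc, ho⟩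
  refine sum_three_squares_of_dvd (b := ((8 * v + 3 : ℕ) : ℤ)) (by positivity) ?_ (c := c') ?_
  · rw [hp'']; have := hp.pos; positivity
  · rw [hp'']
    refine IsCoprime.mul_dvd ?_ ?_ hc'
    · exact Nat.isCoprime_iff_coprime.mpr (Nat.coprime_two_left.mpr hpodd)
    · have ho : Odd ((8 * v + 3 : ℕ) : ℤ) := by exact_mod_cast hbodd
      exact (ho.add_odd hodd.pow).two_dvd

/-! ### Scaling and choice of k -/

theorem linSquareRep_of_int {lam c M k : ℕ} {x y z w : ℤ} (hx : 0 ≤ x) (hy : 0 ≤ y) (hz : 0 ≤ z)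
    (hk : 0 < k) (h : (M : ℤ) = x ^ 2 + y ^ 2 + z ^ 2 + w ^ 2)
    (hl : x + 2 * y + lam * z = c * (k : ℤ) ^ 2) : LinSquareRep lam c M := by
  lift x to ℕ using hx
  lift y to ℕ using hy
  lift z to ℕ using hz
  refine ⟨x, y, z, w.natAbs, ?_, k, hk, by exact_mod_cast hl⟩
  zify
  rw [sq_abs, h]

theorem LinSquareRep.four_mul {lam M : ℕ} (h : LinSquareRep lam 2 M) :
    LinSquareRep lam 1 (4 * M) := by
  obtain ⟨x, y, z, w, h, k, hk, hl⟩ := h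
  exact ⟨2 * x, 2 * y, 2 * z, 2 * w, by rw [h]; ring, 2 * k, by omega, by linarith⟩

theorem LinSquareRep.sixteen_mul {lam M : ℕ} (h : LinSquareRep lam 1 M) :
    LinSquareRep lam 1 (16 * M) := by
  obtain ⟨x, y, z, w, h, k, hk, hl⟩ := h
  exact ⟨4 * x, 4 * y, 4 * z, 4 * w, by rw [h]; ring, 2 * k, by omega, by linarith⟩

theorem exists_mul_pow_four_le_lt (c M : ℕ) (hc : 0 < c) :
    ∃ i, c * i ^ 4 ≤ M ∧ M < c * (i + 1) ^ 4 := by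
  induction M with
  | zero => exact ⟨0, by simp, by simpa using hc⟩
  | succ M ih =>
    obtain ⟨i, h1, h2⟩ := ih
    rcases Nat.lt_or_ge (M + 1) (c * (i + 1) ^ 4) with h | h
    · exact ⟨i, by omega, h⟩
    · refine ⟨i + 1, h, lt_of_le_of_lt h2 ?_⟩
      gcongr
      omega

theorem exists_le_mul_pow_four_le_lt {c M i₀ : ℕ} (hc : 0 < c) (h : c * i₀ ^ 4 ≤ M) :
    ∃ i, i₀ ≤ i ∧ c * i ^ 4 ≤ M ∧ M < c * (i + 1) ^ 4 := by
  obtain ⟨i, h1, h2⟩ := exists_mul_pow_four_le_lt c M hc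
  refine ⟨i, ?_, h1, h2⟩
  by_contra! hi
  have : c * (i + 1) ^ 4 ≤ c * i₀ ^ 4 := by gcongr; omega
  omega

/-! ### The case λ = 2 -/

theorem exists_three_dvd_add (u v w : ℤ) : ∃ a b c : ℤ,
    a ^ 2 + b ^ 2 + c ^ 2 = u ^ 2 + v ^ 2 + w ^ 2 ∧ 3 ∣ a + b ∧ 0 ≤ a + b := by
  have key : ∃ a b c : ℤ, a ^ 2 + b ^ 2 + c ^ 2 = u ^ 2 + v ^ 2 + w ^ 2 ∧ 3 ∣ a + b := by
    have h : 3 ∣ u + v ∨ 3 ∣ u + -v ∨ 3 ∣ u + w ∨ 3 ∣ u + -w ∨ 3 ∣ v + w ∨ 3 ∣ v + -w := by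
      have hu : u % 3 = 0 ∨ u % 3 = 1 ∨ u % 3 = 2 := by omega
      have hv : v % 3 = 0 ∨ v % 3 = 1 ∨ v % 3 = 2 := by omega
      have hw : w % 3 = 0 ∨ w % 3 = 1 ∨ w % 3 = 2 := by omega
      rcases hu with hu | hu | hu <;> rcases hv with hv | hv | hv <;>
        rcases hw with hw | hw | hw <;> omega
    rcases h with h | h | h | h | h | h
    · exact ⟨u, v, w, by ring, h⟩
    · exact ⟨u, -v, w, by ring, h⟩
    · exact ⟨u, w, v, by ring, h⟩
    · exact ⟨u, -w, v, by ring, h⟩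
    · exact ⟨v, w, u, by ring, h⟩
    · exact ⟨v, -w, u, by ring, h⟩
  obtain ⟨a, b, c, h, h3⟩ := key
  rcases le_total 0 (a + b) with h0 | h0
  · exact ⟨a, b, c, h, h3, h0⟩
  · exact ⟨-a, -b, c, by rw [← h]; ring, by omega, by omega⟩

/-- With a + b = 3s, the vector (2s, s - b, b - 2s) is orthogonal to (1, 2, 2) and has norm a² + b².
The bound on m makes its addition to j²(1, 2, 2) nonnegative. -/
theorem linSquareRep_two_of_sum_three_squares {m j : ℕ} {u v w : ℤ} (hj : 0 < j)
    (h : (m : ℤ) - 9 * (j : ℤ) ^ 4 = u ^ 2 + v ^ 2 + w ^ 2) (hm : 5 * m ≤ 81 * j ^ 4) :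
    LinSquareRep 2 1 m := by
  obtain ⟨a, b, c, habc, ⟨s, hs⟩, h0⟩ := exists_three_dvd_add u v w
  zify at hm
  have hN : 5 * (a ^ 2 + b ^ 2) ≤ (6 * (j : ℤ) ^ 2) ^ 2 := by nlinarith [sq_nonneg c]
  have h1 : 2 * b - a ≤ 6 * (j : ℤ) ^ 2 :=
    le_of_abs_le (abs_le_of_sq_le_sq (by nlinarith [sq_nonneg (2 * a + b)]) (by positivity))
  have h2 : 2 * a - b ≤ 6 * (j : ℤ) ^ 2 :=
    le_of_abs_le (abs_le_of_sq_le_sq (by nlinarith [sq_nonneg (a + 2 * b)]) (by positivity))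
  have hj2 : 0 ≤ (j : ℤ) ^ 2 := by positivity
  obtain rfl : a = 3 * s - b := by linarith
  refine linSquareRep_of_int (x := (j : ℤ) ^ 2 + 2 * s) (y := 2 * (j : ℤ) ^ 2 + s - b)
    (z := 2 * (j : ℤ) ^ 2 + b - 2 * s) (w := c) (k := 3 * j) (by omega) (by omega) (by omega)
    (by omega) ?_ (by push_cast; ring)
  linear_combination h - habc

theorem linSquareRep_two {b : ℕ} : LinSquareRep 2 1 (4 * b + 1) := by
  rcases Nat.lt_or_ge b 86437 with hb | hb
  · exact linSquareRep_two_one hb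
  -- Even j = 2i keeps m - 9j⁴ ≡ 1 mod 4; 7 is the least i with 5(i + 1)⁴ ≤ 9i⁴.
  obtain ⟨i, hi, h1, h2⟩ := exists_le_mul_pow_four_le_lt (c := 144) (M := 4 * b + 1) (i₀ := 7)
    (by norm_num) (by omega)
  obtain ⟨u, v, w, h⟩ := sum_three_squares_of_mod_four_eq_one (n := 4 * b + 1 - 144 * i ^ 4)
    (by omega)
  refine linSquareRep_two_of_sum_three_squares (j := 2 * i) (u := u) (v := v) (w := w) (by omega)
    ?_ ?_
  · rw [← h, Nat.cast_sub h1]; push_cast; ring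
  · obtain ⟨s, rfl⟩ := Nat.exists_eq_add_of_le hi
    nlinarith

theorem linSquareRep_two_four_mul {b : ℕ} : LinSquareRep 2 1 (4 * (4 * b + 1)) := by
  rcases Nat.lt_or_ge b 21610 with hb | hb
  · exact (linSquareRep_two_two hb).four_mul
  obtain ⟨i, hi, h1, h2⟩ := exists_le_mul_pow_four_le_lt (c := 36) (M := 4 * b + 1) (i₀ := 7)
    (by norm_num) (by omega)
  obtain ⟨u, v, w, h⟩ := sum_three_squares_of_mod_four_eq_one (n := 4 * b + 1 - 36 * i ^ 4)
    (by omega)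
  refine linSquareRep_two_of_sum_three_squares (j := 2 * i) (u := 2 * u) (v := 2 * v) (w := 2 * w)
    (by omega) ?_ ?_
  · rw [Nat.cast_sub h1] at h
    push_cast at h ⊢
    linear_combination 4 * h
  · obtain ⟨s, rfl⟩ := Nat.exists_eq_add_of_le hi
    nlinarith

/-! ### The case λ = 3 -/

/-- The quaternion `t + A i + B j + C k` annihilates `1 + 2 i + 3 j` modulo `7` on the right. -/
def NullModSeven (t A B C : ℤ) : Prop :=
  7 ∣ t - 2 * A - 3 * B ∧ 7 ∣ 2 * t + A - 3 * C

theorem NullModSeven.rotate {t A B C : ℤ} (h : NullModSeven t A B C) :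
    NullModSeven t (-C) A (-B) := by
  obtain ⟨h1, h2⟩ := h
  constructor <;> omega

/-- The eight triples are the images of (A, B, C) under the cube rotations preserving the third
axis. -/
theorem zmod_seven_null_vector : ∀ t A B C : ZMod 7, t ^ 2 + A ^ 2 + B ^ 2 + C ^ 2 = 0 →
    ∃ p ∈ [(A, B, C), (A, -B, -C), (-A, B, -C), (-A, -B, C), (B, A, -C), (B, -A, C), (-B, A, C),
      (-B, -A, -C)], t - 2 * p.1 - 3 * p.2.1 = 0 ∧ 2 * t + p.1 - 3 * p.2.2 = 0 := by
  decide +kernel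

theorem exists_nullModSeven {t A B C : ℤ} (h : 7 ∣ t ^ 2 + A ^ 2 + B ^ 2 + C ^ 2) :
    ∃ A' B' C' : ℤ, A' ^ 2 + B' ^ 2 + C' ^ 2 = A ^ 2 + B ^ 2 + C ^ 2 ∧
      NullModSeven t A' B' C' := by
  have key (A' B' C' : ℤ) (h1 : (t - 2 * A' - 3 * B' : ZMod 7) = 0)
      (h2 : (2 * t + A' - 3 * C' : ZMod 7) = 0) : NullModSeven t A' B' C' :=
    ⟨(ZMod.intCast_zmod_eq_zero_iff_dvd _ 7).mp (by push_cast; exact h1),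
      (ZMod.intCast_zmod_eq_zero_iff_dvd _ 7).mp (by push_cast; exact h2)⟩
  have h0 : (t ^ 2 + A ^ 2 + B ^ 2 + C ^ 2 : ZMod 7) = 0 := by
    exact_mod_cast (ZMod.intCast_zmod_eq_zero_iff_dvd _ 7).mpr h
  obtain ⟨p, hp, h1, h2⟩ := zmod_seven_null_vector t A B C h0
  simp only [List.mem_cons, List.not_mem_nil, or_false] at hp
  rcases hp with rfl | rfl | rfl | rfl | rfl | rfl | rfl | rfl
  · exact ⟨A, B, C, by ring, key _ _ _ h1 h2⟩
  · exact ⟨A, -B, -C, by ring, key _ _ _ (by push_cast; exact h1) (by push_cast; exact h2)⟩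
  · exact ⟨-A, B, -C, by ring, key _ _ _ (by push_cast; exact h1) (by push_cast; exact h2)⟩
  · exact ⟨-A, -B, C, by ring, key _ _ _ (by push_cast; exact h1) (by push_cast; exact h2)⟩
  · exact ⟨B, A, -C, by ring, key _ _ _ h1 (by push_cast; exact h2)⟩
  · exact ⟨B, -A, C, by ring, key _ _ _ (by push_cast; exact h1) h2⟩
  · exact ⟨-B, A, C, by ring, key _ _ _ (by push_cast; exact h1) (by push_cast; exact h2)⟩
  · exact ⟨-B, -A, -C, by ring, key _ _ _ (by push_cast; exact h1) (by push_cast; exact h2)⟩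

/-- The product (t + Ai + Bj + Ck)(1 + 2i + 3j), with t = k², is 14(x + yi + zj + wk);
multiplicativity of the norm gives m. -/
theorem linSquareRep_three_of_null {m k : ℕ} {A B C : ℤ} (hk : 0 < k)
    (h : ((k : ℤ) ^ 2) ^ 2 + A ^ 2 + B ^ 2 + C ^ 2 = 14 * m) (hnull : NullModSeven ((k : ℤ) ^ 2) A B C)
    (hB : 2 ∣ (k : ℤ) ^ 2 - B) (hAC : 2 ∣ A - C) (hx : 2 * A + 3 * B ≤ (k : ℤ) ^ 2)
    (hm : 10 * (m : ℤ) ≤ ((k : ℤ) ^ 2) ^ 2) : LinSquareRep 3 1 m := by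
  have ht : 0 ≤ (k : ℤ) ^ 2 := by positivity
  generalize hT : (k : ℤ) ^ 2 = t at *
  have hN : 10 * (A ^ 2 + B ^ 2 + C ^ 2) ≤ (2 * t) ^ 2 := by linarith
  have hy : -(A - 3 * C) ≤ 2 * t :=
    le_of_abs_le (abs_le_of_sq_le_sq
      (by nlinarith [sq_nonneg (3 * A + C), sq_nonneg B]) (by positivity))
  have hz : -(B + 2 * C) ≤ 2 * t :=
    le_of_abs_le (abs_le_of_sq_le_sq
      (by nlinarith [sq_nonneg (2 * B - C), sq_nonneg A, sq_nonneg B, sq_nonneg C]) (by positivity))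
  obtain ⟨h1, h2⟩ := hnull
  obtain ⟨x, hx'⟩ : (14 : ℤ) ∣ t - 2 * A - 3 * B := by omega
  obtain ⟨y, hy'⟩ : (14 : ℤ) ∣ 2 * t + A - 3 * C := by omega
  obtain ⟨z, hz'⟩ : (14 : ℤ) ∣ 3 * t + B + 2 * C := by omega
  obtain ⟨w, hw'⟩ : (14 : ℤ) ∣ C + 3 * A - 2 * B := by omega
  refine linSquareRep_of_int (x := x) (y := y) (z := z) (w := w) (k := k) (by omega) (by omega)
    (by omega) hk ?_ (by rw [hT]; push_cast; omega)
  have e : (14 * x) ^ 2 + (14 * y) ^ 2 + (14 * z) ^ 2 + (14 * w) ^ 2 = 14 * (14 * (m : ℤ)) := by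
    rw [← hx', ← hy', ← hz', ← hw', ← h]; ring
  linarith

theorem linSquareRep_three_of_sum_three_squares {m k : ℕ} {u v w : ℤ} (hk : 0 < k)
    (h : 14 * (m : ℤ) - (k : ℤ) ^ 4 = u ^ 2 + v ^ 2 + w ^ 2) (hm : 13 * m ≤ k ^ 4) :
    LinSquareRep 3 1 m := by
  obtain ⟨A, B, C, habc, hnull⟩ := exists_nullModSeven (t := (k : ℤ) ^ 2) (A := u) (B := v) (C := w)
    ⟨2 * m, by linear_combination -h⟩
  have parity (A B C : ℤ) (habc : A ^ 2 + B ^ 2 + C ^ 2 = u ^ 2 + v ^ 2 + w ^ 2) :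
      2 ∣ (k : ℤ) ^ 2 + A + B + C := by
    have h2 : Even (((k : ℤ) ^ 2) ^ 2 + A ^ 2 + B ^ 2 + C ^ 2) :=
      ⟨7 * m, by linear_combination habc - h⟩
    rw [← even_iff_two_dvd]
    simpa [Int.even_add, Int.even_pow] using h2
  have key (A B C : ℤ) (habc : A ^ 2 + B ^ 2 + C ^ 2 = u ^ 2 + v ^ 2 + w ^ 2)
      (hnull : NullModSeven ((k : ℤ) ^ 2) A B C) (hB : 2 ∣ (k : ℤ) ^ 2 - B) :
      LinSquareRep 3 1 m := by
    zify at hm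
    have hs : ((k : ℤ) ^ 2) ^ 2 + A ^ 2 + B ^ 2 + C ^ 2 = 14 * m := by linear_combination habc - h
    refine linSquareRep_three_of_null hk hs hnull hB ?_ ?_ (by linarith)
    · have := parity A B C habc
      omega
    · refine le_of_abs_le (abs_le_of_sq_le_sq ?_ (by positivity))
      nlinarith [sq_nonneg (3 * A - 2 * B), sq_nonneg C]
  have h2 := parity A B C habc
  -- The order-three rotation preserves the condition modulo 7 and moves an entry of the parity of
  -- k² into the place of B.
  have hpar : 2 ∣ (k : ℤ) ^ 2 - B ∨ 2 ∣ (k : ℤ) ^ 2 - A ∨ 2 ∣ (k : ℤ) ^ 2 - -C := by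
    omega
  rcases hpar with hp | hp | hp
  · exact key A B C habc hnull hp
  · exact key _ _ _ (by rw [← habc]; ring) hnull.rotate hp
  · exact key _ _ _ (by rw [← habc]; ring) hnull.rotate.rotate hp

theorem linSquareRep_three_four_mul_of_sum_three_squares {M l : ℕ} {u v w : ℤ} (hl : 0 < l)
    (h : 14 * (M : ℤ) - 4 * (l : ℤ) ^ 4 = u ^ 2 + v ^ 2 + w ^ 2) (hM : 25 * M ≤ 8 * l ^ 4) :
    LinSquareRep 3 1 (4 * M) := by
  obtain ⟨A, B, C, habc, hnull⟩ := exists_nullModSeven (t := 2 * (l : ℤ) ^ 2) (A := u) (B := v)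
    (C := w) ⟨2 * M, by linear_combination -h⟩
  zify at hM
  have key (A B C : ℤ) (habc : A ^ 2 + B ^ 2 + C ^ 2 = u ^ 2 + v ^ 2 + w ^ 2)
      (hnull : NullModSeven (2 * (l : ℤ) ^ 2) A B C) (hx : 2 * A + 3 * B ≤ 2 * (l : ℤ) ^ 2) :
      LinSquareRep 3 1 (4 * M) := by
    obtain ⟨h1, h2⟩ := hnull
    have e : ((2 * l : ℕ) : ℤ) ^ 2 = 2 * (2 * (l : ℤ) ^ 2) := by push_cast; ring
    refine linSquareRep_three_of_null (k := 2 * l) (A := 2 * A) (B := 2 * B) (C := 2 * C) (by omega)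
      ?_ ?_ ?_ ?_ ?_ ?_
    · push_cast
      linear_combination 4 * (habc - h)
    · rw [e]
      constructor <;> omega
    · rw [e]; omega
    · omega
    · rw [e]; omega
    · push_cast
      linarith
  -- Doubling settles parity, so the rotation is free to make x ≥ 0: the three values sum to 5(A + B
  -- - C), which is too small for all to exceed 2l².
  have hmin : 2 * A + 3 * B ≤ 2 * (l : ℤ) ^ 2 ∨ 2 * -C + 3 * A ≤ 2 * (l : ℤ) ^ 2 ∨
      2 * - -B + 3 * -C ≤ 2 * (l : ℤ) ^ 2 := by
    by_contra! hc
    obtain ⟨c1, c2, c3⟩ := hc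
    have hl2 : 0 ≤ (l : ℤ) ^ 2 := by positivity
    have h1 : (3 * (2 * (l : ℤ) ^ 2)) ^ 2 < (5 * (A + B - C)) ^ 2 :=
      pow_lt_pow_left₀ (by linarith) (by positivity) two_ne_zero
    nlinarith [sq_nonneg (A - B), sq_nonneg (A + C), sq_nonneg (B + C)]
  rcases hmin with hp | hp | hp
  · exact key A B C habc hnull hp
  · exact key _ _ _ (by rw [← habc]; ring) hnull.rotate hp
  · exact key _ _ _ (by rw [← habc]; ring) hnull.rotate.rotate hp

theorem linSquareRep_three {b : ℕ} : LinSquareRep 3 1 (4 * b + 1) := by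
  rcases Nat.lt_or_ge b 151841 with hb | hb
  · exact linSquareRep_three_one hb
  -- 54 is the least k with 13(k + 1)⁴ ≤ 14k⁴.
  obtain ⟨k, hk, h1, h2⟩ := exists_le_mul_pow_four_le_lt (c := 1) (M := 14 * (4 * b + 1)) (i₀ := 54)
    (by norm_num) (by omega)
  rw [one_mul] at h1 h2
  have hk4 : k ^ 4 % 4 = 0 ∨ k ^ 4 % 4 = 1 := by
    have : k % 4 = 0 ∨ k % 4 = 1 ∨ k % 4 = 2 ∨ k % 4 = 3 := by omega
    rcases this with h | h | h | h <;> simp [Nat.pow_mod, h]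
  obtain ⟨u, v, w, h⟩ : ∃ u v w : ℤ, ((14 * (4 * b + 1) - k ^ 4 : ℕ) : ℤ) =
      u ^ 2 + v ^ 2 + w ^ 2 := by
    rcases hk4 with hk4 | hk4
    · exact sum_three_squares_of_mod_four_eq_two (by omega)
    · exact sum_three_squares_of_mod_four_eq_one (by omega)
  refine linSquareRep_three_of_sum_three_squares (k := k) (u := u) (v := v) (w := w) (by omega) ?_ ?_
  · rw [← h, Nat.cast_sub h1]; push_cast; ring
  · obtain ⟨s, rfl⟩ := Nat.exists_eq_add_of_le hk
    nlinarith

theorem linSquareRep_three_four_mul {b : ℕ} : LinSquareRep 3 1 (4 * (4 * b + 1)) := by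
  rcases Nat.lt_or_ge b 107188 with hb | hb
  · exact (linSquareRep_three_two hb).four_mul
  -- 35 is the least l with 25(l + 1)⁴ ≤ 28l⁴.
  obtain ⟨l, hl, h1, h2⟩ := exists_le_mul_pow_four_le_lt (c := 2) (M := 7 * (4 * b + 1)) (i₀ := 35)
    (by norm_num) (by omega)
  obtain ⟨u, v, w, h⟩ := sum_three_squares_of_mod_four_eq_two
    (n := 14 * (4 * b + 1) - 4 * l ^ 4) (by omega)
  refine linSquareRep_three_four_mul_of_sum_three_squares (l := l) (u := u) (v := v) (w := w)
    (by omega) ?_ ?_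
  · rw [← h, Nat.cast_sub (by omega)]; push_cast; ring
  · obtain ⟨s, rfl⟩ := Nat.exists_eq_add_of_le hl
    nlinarith

theorem linSquareRep_four_pow_mul {lam b : ℕ} (hlam : lam = 2 ∨ lam = 3) :
    ∀ a : ℕ, LinSquareRep lam 1 (4 ^ a * (4 * b + 1))
  | 0 => by
    rw [pow_zero, one_mul]
    rcases hlam with rfl | rfl
    exacts [linSquareRep_two, linSquareRep_three]
  | 1 => by
    rw [pow_one]
    rcases hlam with rfl | rfl
    exacts [linSquareRep_two_four_mul, linSquareRep_three_four_mul]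
  | a + 2 => by
    have e : 4 ^ (a + 2) * (4 * b + 1) = 16 * (4 ^ a * (4 * b + 1)) := by ring
    rw [e]
    exact (linSquareRep_four_pow_mul hlam a).sixteen_mul

theorem theorem1p1 (lam : ℕ) (hlam : lam = 2 ∨ lam = 3) (m : ℕ) (hm : ∃ a b : ℕ, m = 4 ^ a * (4 * b + 1)) :
    ∃ x y z w : ℕ, m = x ^ 2 + y ^ 2 + z ^ 2 + w ^ 2 ∧
      ∃ k : ℕ, 0 < k ∧ x + 2 * y + lam * z = k ^ 2 := by
  obtain ⟨a, b, rfl⟩ := hm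
  simpa only [LinSquareRep, one_mul] using linSquareRep_four_pow_mul (b := b) hlam a
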